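/- Let $\Delta$ be the open unit disc in $\mathbb C$ and let $V\subset\mathbb C$ be a bounded open set. A *weight* on an open set $U\subset\mathbb C$ is a continuous, bounded, strictly positive function on $U$. For a weight $v$ on $U$, $\mathcal H_v(U)$ is the space of holomorphic $f$ on $U$ with $\|f\|_v=\sup_{z\in U}v(z)|f(z)|<\infty$, and $\mathcal H_{v_o}(U)$ is the subspace of those $f$ such that for every $\varepsilon>0$ there is a compact $K\subset U$ with $v(z)|f(z)|<\varepsilon$ on $U\setminus K$. Write $\delta_z(f)=f(z)$. The weight $v$ is *complete* if for every $z\in U$ the functional $v(z)\delta_z$ is an extreme point of the closed unit ball of the dual $\mathcal H_{v_o}(U)'$. Let $v$ be a complete weight on $\Delta$, let $w$ be a weight on $V$, and let $T\colon\mathcal H_{v_o}(\Delta)\to\mathcal H_{w_o}(V)$ be a (complex-linear, not necessarily surjective) isometry. Let $\mathcal B_w^T(V)$ be the set of all $z\in V$ such that $w(z)\delta_z$ is an extreme point of the closed unit ball of the dual $T(\mathcal H_{v_o}(\Delta))'$. Say that $T$ is *induced* by $(\varphi,h)$ if $\varphi\colon V\to\Delta$ is an analytic surjection, $h$ is analytic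 on $V$ and $$T(f)(z)=h(z)\,f(\varphi(z))\qquad\text{for all } f\in\mathcal H_{v_o}(\Delta),\ z\in V.$$ (i) If $V$ is connected and $\mathcal H_{v_o}(\Delta)\neq\{0\}$, then $T$ is induced by some pair $(\varphi,h)$. (ii) Whenever $T$ is induced by $(\varphi,h)$, then for every $a\in\Delta$ and every $r>0$ the set $$\overline{\mathcal B_w^T(V)\cap\varphi^{-1}(B(a,r))}$$ has non-empty interior, where $B(a,r)=\{z\in\mathbb C:|z-a|<r\}$. -/

import Mathlib

noncomputable section

/-- A weight on `U ⊆ ℂ`: a continuous, bounded, strictly positive function on `U`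
(values outside `U` are irrelevant). -/
structure Weight (U : Set ℂ) where
  toFun : ℂ → ℝ
  continuousOn : ContinuousOn toFun U
  pos : ∀ z ∈ U, 0 < toFun z
  bounded : ∃ C : ℝ, ∀ z ∈ U, toFun z ≤ C

namespace Weight

variable {U : Set ℂ}

instance : CoeFun (Weight U) (fun _ => ℂ → ℝ) := ⟨Weight.toFun⟩

/-- The vector space of holomorphic functions `f` on `U` with `sup_{z ∈ U} v(z)|f(z)| < ∞`.
A function on `U` is represented by its extension by zero to `ℂ`. -/
def HSubmodule (v : Weight U) : Submodule ℂ (ℂ → ℂ) where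
  carrier := {f | DifferentiableOn ℂ f U ∧ (∀ z, z ∉ U → f z = 0) ∧
    ∃ C : ℝ, ∀ z ∈ U, v z * ‖f z‖ ≤ C}
  zero_mem' := ⟨differentiableOn_const 0, fun _ _ => rfl, 0, fun z _ => by simp⟩
  add_mem' := by
    rintro f g ⟨hf, hf0, C, hC⟩ ⟨hg, hg0, D, hD⟩
    refine ⟨hf.add hg, fun z hz => by simp [hf0 z hz, hg0 z hz], C + D, fun z hz => ?_⟩
    calc v z * ‖f z + g z‖ ≤ v z * (‖f z‖ + ‖g z‖) :=
          mul_le_mul_of_nonneg_left (norm_add_le _ _) (v.pos z hz).le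
      _ ≤ C + D := by rw [mul_add]; exact add_le_add (hC z hz) (hD z hz)
  smul_mem' := by
    rintro c f ⟨hf, hf0, C, hC⟩
    refine ⟨hf.const_smul c, fun z hz => by simp [hf0 z hz], ‖c‖ * C, fun z hz => ?_⟩
    have h := mul_le_mul_of_nonneg_left (hC z hz) (norm_nonneg c)
    simpa [mul_left_comm] using h

/-- The space `H_v(U)`. It is a type of its own, so that its topology is the one of the norm
below, not the topology of pointwise convergence. -/
def H (v : Weight U) : Type := v.HSubmodule

instance (v : Weight U) : AddCommGroup v.H := inferInstanceAs (AddCommGroup v.HSubmodule)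

instance (v : Weight U) : Module ℂ v.H := inferInstanceAs (Module ℂ v.HSubmodule)

/-- The elements of `H_v(U)` as functions. -/
instance (v : Weight U) : CoeFun v.H (fun _ => ℂ → ℂ) := ⟨Subtype.val⟩

@[simp] theorem coe_zero (v : Weight U) (z : ℂ) : (0 : v.H) z = 0 := rfl

@[simp] theorem coe_add (v : Weight U) (f g : v.H) (z : ℂ) : (f + g) z = f z + g z := rfl

@[simp] theorem coe_smul (v : Weight U) (c : ℂ) (f : v.H) (z : ℂ) : (c • f) z = c * f z := rfl

/-- The norm `‖f‖_v = sup_{z ∈ U} v(z)|f(z)|`. -/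
instance (v : Weight U) : Norm v.H := ⟨fun f => ⨆ z : U, v z * ‖f z‖⟩

theorem norm_def (v : Weight U) (f : v.H) : ‖f‖ = ⨆ z : U, v z * ‖f z‖ := rfl

theorem bddAbove (v : Weight U) (f : v.H) :
    BddAbove (Set.range fun z : U => v z * ‖f z‖) := by
  obtain ⟨C, hC⟩ := f.2.2.2
  exact ⟨C, by rintro _ ⟨z, rfl⟩; exact hC z z.2⟩

theorem le_norm (v : Weight U) (f : v.H) (z : U) : v z * ‖f z‖ ≤ ‖f‖ :=
  le_ciSup (v.bddAbove f) z

theorem norm_nonneg' (v : Weight U) (f : v.H) : 0 ≤ ‖f‖ :=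
  Real.iSup_nonneg fun z => mul_nonneg (v.pos z z.2).le (norm_nonneg _)

theorem normCore (v : Weight U) : NormedSpace.Core ℂ v.H where
  norm_nonneg := v.norm_nonneg'
  norm_smul c f := by
    rw [norm_def, norm_def, Real.mul_iSup_of_nonneg (norm_nonneg c)]
    exact iSup_congr fun z => by simp [mul_left_comm]
  norm_triangle f g := by
    refine Real.iSup_le (fun z => ?_) (add_nonneg (v.norm_nonneg' f) (v.norm_nonneg' g))
    calc v z * ‖f z + g z‖ ≤ v z * (‖f z‖ + ‖g z‖) :=
          mul_le_mul_of_nonneg_left (norm_add_le _ _) (v.pos z z.2).le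
      _ ≤ ‖f‖ + ‖g‖ := by rw [mul_add]; exact add_le_add (v.le_norm f z) (v.le_norm g z)
  norm_eq_zero_iff f := by
    constructor
    · intro h
      refine Subtype.ext (funext fun z => ?_)
      by_cases hz : z ∈ U
      · have h1 := v.le_norm f ⟨z, hz⟩
        rw [h] at h1
        have h2 : ‖f z‖ ≤ 0 := nonpos_of_mul_nonpos_right h1 (v.pos z hz)
        simpa using h2
      · exact f.2.2.1 z hz
    · rintro rfl
      simp [norm_def]

instance (v : Weight U) : NormedAddCommGroup v.H := NormedAddCommGroup.ofCore v.normCore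

instance (v : Weight U) : NormedSpace ℂ v.H := NormedSpace.ofCore v.normCore

/-- The subspace `H_{v_o}(U)` of all `f ∈ H_v(U)` such that `v(z)|f(z)|` tends to `0` as `z`
tends to the boundary of `U`: for every `ε > 0` there is a compact `K ⊆ U` with
`v(z)|f(z)| < ε` on `U \ K`. -/
def H₀ (v : Weight U) : Submodule ℂ v.H where
  carrier := {f | ∀ ε > 0, ∃ K ⊆ U, IsCompact K ∧ ∀ z ∈ U \ K, v z * ‖f z‖ < ε}
  zero_mem' := fun ε hε => ⟨∅, Set.empty_subset _, isCompact_empty, fun z _ => by simpa using hε⟩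
  add_mem' := by
    intro f g hf hg ε hε
    obtain ⟨K, hKU, hK, h1⟩ := hf (ε / 2) (half_pos hε)
    obtain ⟨L, hLU, hL, h2⟩ := hg (ε / 2) (half_pos hε)
    refine ⟨K ∪ L, Set.union_subset hKU hLU, hK.union hL, fun z hz => ?_⟩
    have a := h1 z ⟨hz.1, fun h => hz.2 (Or.inl h)⟩
    have b := h2 z ⟨hz.1, fun h => hz.2 (Or.inr h)⟩
    have c : v z * ‖f z + g z‖ ≤ v z * (‖f z‖ + ‖g z‖) :=
      mul_le_mul_of_nonneg_left (norm_add_le _ _) (v.pos z hz.1).le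
    change v z * ‖f z + g z‖ < ε
    linarith [mul_add (v z) ‖f z‖ ‖g z‖]
  smul_mem' := by
    intro c f hf ε hε
    have hc : 0 < ‖c‖ + 1 := by positivity
    obtain ⟨K, hKU, hK, h1⟩ := hf (ε / (‖c‖ + 1)) (div_pos hε hc)
    refine ⟨K, hKU, hK, fun z hz => ?_⟩
    have a := (lt_div_iff₀ hc).1 (h1 z hz)
    have b : 0 ≤ v z * ‖f z‖ := mul_nonneg (v.pos z hz.1).le (norm_nonneg _)
    change v z * ‖c * f z‖ < ε
    rw [norm_mul]
    nlinarith

/-- The evaluation functional `δ_z : f ↦ f(z)` on `H_v(U)`, for `z ∈ U`. -/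
def eval (v : Weight U) (z : U) : StrongDual ℂ v.H :=
  LinearMap.mkContinuous
    { toFun := fun f : v.H => f z
      map_add' := fun _ _ => rfl
      map_smul' := fun _ _ => rfl } (v z)⁻¹ (fun f => by
        have h := v.le_norm f z
        rw [inv_mul_eq_div, le_div_iff₀ (v.pos z z.2), mul_comm]
        exact h)

/-- For a subspace `E` of `H_v(U)`: the set of `z ∈ U` such that `v(z)δ_z`, restricted to `E`,
is an extreme point of the closed unit ball of the dual `E'`. -/
def boundaryOf (v : Weight U) (E : Submodule ℂ v.H) : Set ℂ :=
  {z | ∃ hz : z ∈ U, ((v z : ℂ) • (v.eval ⟨z, hz⟩).comp E.subtypeL) ∈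
    Set.extremePoints ℝ {e : StrongDual ℂ E | ‖e‖ ≤ 1}}

/-- The `v`-boundary `B_v(U)` of `U`. -/
def boundary (v : Weight U) : Set ℂ := v.boundaryOf v.H₀

/-- The weight `v` is complete if `B_v(U) = U`. -/
def IsComplete (v : Weight U) : Prop := v.boundary = U

/-- The set `B_w^T(V)`, for an isometry `T : H_{v_o}(U) → H_{w_o}(V)`: all `z ∈ V` such that
`w(z)δ_z` is an extreme point of the closed unit ball of the dual of the range `T(H_{v_o}(U))`. -/
def isometryBoundary {V : Set ℂ} {v : Weight U} {w : Weight V} (T : v.H₀ →ₗᵢ[ℂ] w.H₀) : Set ℂ :=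
  w.boundaryOf ((LinearMap.range T.toLinearMap).map w.H₀.subtype)

/-- `φ` is an analytic surjection of `V` onto `U` and `h` is analytic on `V`, with
`T(f)(z) = h(z) f(φ(z))` for all `f ∈ H_{v_o}(U)` and `z ∈ V`. -/
structure Induces {V : Set ℂ} {v : Weight U} {w : Weight V} (T : v.H₀ →ₗᵢ[ℂ] w.H₀)
    (φ h : ℂ → ℂ) : Prop where
  differentiableOn_map : DifferentiableOn ℂ φ V
  image_eq : φ '' V = U
  differentiableOn_factor : DifferentiableOn ℂ h V
  apply_eq : ∀ (f : v.H₀), ∀ z ∈ V, (T f : w.H) z = h z * (f : v.H) (φ z)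

end Weight

end

open Set Filter Topology Metric

/-!
Embed `H₀` isometrically in `C₀(V)`. By Milman's theorem an extreme point of the dual ball of a
subspace of `C₀(V)` is a unimodular multiple of a point evaluation, so each `a` in the domain `U`
of a complete weight `v` has a point `z ∈ V` and a scalar `κ` with `w z * ‖κ‖ = v a` and
`T g z = κ * g a` for all `g`.

Existence of `φ` and `h`. Let `M` be multiplication by the coordinate. At these uncountably many
points `z` the identities `T (M ^ (n + 1) f) * (T f) ^ n = (T (M f)) ^ (n + 1)` hold, hence
they hold on all of the connected set `V`. Letting `n → ∞` they force each zero of `T f` to be a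
zero of `T (M f)` of at least the same order, so `φ = T (M f) / T f` is analytic; it does not
depend on `f`. The functional `g ↦ T g z` is then an eigenfunctional of `M` for the eigenvalue
`φ z`: it vanishes if `φ z` is outside the closure of `U`, and is a multiple of evaluation at `φ z`
if `φ z ∈ U`.

Interior of the boundary. Every point of the relatively closed set
`{z ∈ V | v (φ z) ≤ w z * ‖h z‖}` belongs to the boundary of `T`, and `φ` maps this set onto `U`.
If it had no interior point over an open `W ⊆ U`, its part over `W` would be meagre; but analytic
maps send meagre sets to meagre sets, contradicting the Baire category theorem in `W`.
-/

section ExtremePoints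

theorem isCompact_convexJoin {E : Type*} [AddCommGroup E] [Module ℝ E] [TopologicalSpace E]
    [ContinuousAdd E] [ContinuousSMul ℝ E] {s t : Set E} (hs : IsCompact s) (ht : IsCompact t) :
    IsCompact (convexJoin ℝ s t) := by
  have himage : convexJoin ℝ s t =
      (fun p : ℝ × E × E => (1 - p.1) • p.2.1 + p.1 • p.2.2) '' (Icc (0 : ℝ) 1 ×ˢ s ×ˢ t) := by
    ext x
    simp only [mem_convexJoin, segment_eq_image, mem_image, mem_prod, Prod.exists]
    grind
  rw [himage]
  exact (isCompact_Icc.prod (hs.prod ht)).image (by fun_prop)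

section Milman

variable {E : Type*} [AddCommGroup E] [Module ℝ E] [TopologicalSpace E] {K A : Set E} {x : E}

theorem exists_isCompact_convex_union_of_mem_extremePoints [ContinuousAdd E]
    [ContinuousSMul ℝ E] (hKc : Convex ℝ K) (hx : x ∈ K.extremePoints ℝ) {s t : Set E}
    (hs : ∃ C, IsCompact C ∧ Convex ℝ C ∧ C ⊆ K ∧ x ∉ C ∧ s ⊆ C)
    (ht : ∃ D, IsCompact D ∧ Convex ℝ D ∧ D ⊆ K ∧ x ∉ D ∧ t ⊆ D) :
    ∃ D, IsCompact D ∧ Convex ℝ D ∧ D ⊆ K ∧ x ∉ D ∧ s ∪ t ⊆ D := by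
  obtain ⟨C, hC, hCc, hCK, hxC, hsC⟩ := hs
  obtain ⟨D, hD, hDc, hDK, hxD, htD⟩ := ht
  rcases C.eq_empty_or_nonempty with rfl | hCne
  · exact ⟨D, hD, hDc, hDK, hxD, union_subset (hsC.trans (empty_subset _)) htD⟩
  rcases D.eq_empty_or_nonempty with rfl | hDne
  · exact ⟨C, hC, hCc, hCK, hxC, union_subset hsC (htD.trans (empty_subset _))⟩
  refine ⟨convexJoin ℝ C D, isCompact_convexJoin hC hD, hCc.convexJoin hDc,
    convexJoin_subset hCK hDK hKc, fun hmem => ?_,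
    union_subset (hsC.trans (subset_convexJoin_left hDne))
      (htD.trans (subset_convexJoin_right hCne))⟩
  obtain ⟨c, hc, d, hd, hcd⟩ := mem_convexJoin.1 hmem
  rcases (mem_extremePoints_iff_forall_segment.1 hx).2 c (hCK hc) d (hDK hd) hcd with rfl | rfl
  · exact hxC hc
  · exact hxD hd

theorem exists_isCompact_convex_mem_nhdsWithin [ContinuousSMul ℝ E] [IsTopologicalAddGroup E]
    [LocallyConvexSpace ℝ E] [T2Space E] (hK : IsCompact K) (hKc : Convex ℝ K) {a : E}
    (hax : a ≠ x) : ∃ D, IsCompact D ∧ Convex ℝ D ∧ D ⊆ K ∧ x ∉ D ∧ D ∈ 𝓝[K] a := by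
  obtain ⟨O, O', hO, hO', haO, hxO', hdisj⟩ := t2_separation hax
  obtain ⟨C, ⟨hCa, hCc⟩, hCO⟩ :=
    (LocallyConvexSpace.convex_basis (𝕜 := ℝ) a).mem_iff.1 (hO.mem_nhds haO)
  refine ⟨K ∩ closure C, hK.inter_right isClosed_closure, hKc.inter hCc.closure,
    inter_subset_left, fun hxC => ?_, ?_⟩
  · exact ((hdisj.mono_left hCO).closure_left hO').le_bot ⟨hxC.2, hxO'⟩
  · exact inter_mem self_mem_nhdsWithin
      (mem_nhdsWithin_of_mem_nhds (mem_of_superset hCa subset_closure))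

/-- **Milman's theorem**. -/
theorem mem_of_mem_extremePoints_of_subset_closure_convexHull [IsTopologicalAddGroup E]
    [ContinuousSMul ℝ E] [LocallyConvexSpace ℝ E] [T2Space E] (hK : IsCompact K)
    (hKc : Convex ℝ K) (hA : IsCompact A) (hAK : A ⊆ K) (hKA : K ⊆ closure (convexHull ℝ A))
    (hx : x ∈ K.extremePoints ℝ) : x ∈ A := by
  by_contra hxA
  obtain ⟨D, hD, hDc, -, hxD, hAD⟩ :
      ∃ D, IsCompact D ∧ Convex ℝ D ∧ D ⊆ K ∧ x ∉ D ∧ A ⊆ D := by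
    refine hA.induction_on (p := fun s => ∃ D, IsCompact D ∧ Convex ℝ D ∧ D ⊆ K ∧ x ∉ D ∧ s ⊆ D)
      ⟨∅, by simp [convex_empty]⟩ ?_
      (fun s t => exists_isCompact_convex_union_of_mem_extremePoints hKc hx) fun a ha => ?_
    · rintro s t hst ⟨D, hD, hDc, hDK, hxD, htD⟩
      exact ⟨D, hD, hDc, hDK, hxD, hst.trans htD⟩
    · obtain ⟨D, hD, hDc, hDK, hxD, hDa⟩ :=
        exists_isCompact_convex_mem_nhdsWithin hK hKc (ne_of_mem_of_not_mem ha hxA)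
      exact ⟨D, nhdsWithin_mono a hAK hDa, D, hD, hDc, hDK, hxD, Subset.rfl⟩
  exact hxD (closure_minimal (convexHull_min hAD hDc) hD.isClosed (hKA hx.1))

end Milman

theorem norm_apply_le_of_balanced_of_forall_re_le {𝕜 F : Type*} [RCLike 𝕜] [AddCommGroup F]
    [Module 𝕜 F] {A : Set F} (hA : Balanced 𝕜 A) (f : F →ₗ[𝕜] 𝕜) {u : ℝ}
    (hu : ∀ a ∈ A, RCLike.re (f a) ≤ u) {a : F} (ha : a ∈ A) : ‖f a‖ ≤ u := by
  obtain ⟨c, hc, hca⟩ := RCLike.exists_norm_eq_mul_self (f a)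
  simpa [← hca] using hu (c • a) (hA.smul_mem hc.le ha)

theorem mem_of_mem_extremePoints_of_balanced {𝕜 E : Type*} [RCLike 𝕜] [AddCommGroup E]
    [Module ℝ E] [Module 𝕜 E] [IsScalarTower ℝ 𝕜 E] [TopologicalSpace E]
    [IsTopologicalAddGroup E] [ContinuousSMul 𝕜 E] [LocallyConvexSpace ℝ E] [T2Space E]
    {K A : Set E} (hK : IsCompact K) (hKc : Convex ℝ K) (hA : IsCompact A) (hAK : A ⊆ K)
    (hAb : Balanced 𝕜 A)
    (hKA : ∀ (f : StrongDual 𝕜 E) (u : ℝ), (∀ a ∈ A, ‖f a‖ ≤ u) → ∀ k ∈ K, ‖f k‖ ≤ u) {x : E}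
    (hx : x ∈ K.extremePoints ℝ) : x ∈ A := by
  have : ContinuousSMul ℝ E := IsScalarTower.continuousSMul 𝕜
  refine mem_of_mem_extremePoints_of_subset_closure_convexHull hK hKc hA hAK (fun k hk => ?_) hx
  by_contra hkA
  obtain ⟨f, u, hfA, hfk⟩ := RCLike.geometric_hahn_banach_closed_point (𝕜 := 𝕜)
    (convex_convexHull ℝ A).closure isClosed_closure hkA
  have hf : ∀ a ∈ A, ‖f a‖ ≤ u := fun a ha =>
    norm_apply_le_of_balanced_of_forall_re_le hAb f.toLinearMap
      (fun a ha => (hfA a (subset_closure (subset_convexHull ℝ A ha))).le) ha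
  exact hfk.not_ge ((RCLike.re_le_norm (f k)).trans (hKA f u hf k hk))

section WeakDual

variable {E : Type*} [NormedAddCommGroup E] [NormedSpace ℂ E]

theorem norm_eq_one_of_mem_extremePoints [Nontrivial E] {e : StrongDual ℂ E}
    (he : e ∈ extremePoints ℝ {e : StrongDual ℂ E | ‖e‖ ≤ 1}) : ‖e‖ = 1 := by
  have hball : {e : StrongDual ℂ E | ‖e‖ ≤ 1} = closedBall 0 1 :=
    Set.ext fun e => mem_closedBall_zero_iff.symm
  rw [hball] at he
  exact mem_sphere_zero_iff_norm.1 (extremePoints_closedBall_subset_sphere he)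

theorem toWeakDual_mem_of_mem_extremePoints {A : Set (WeakDual ℂ E)}
    (hA : IsCompact A) (hAb : Balanced ℂ A) (hA1 : A ⊆ WeakDual.toStrongDual ⁻¹' closedBall 0 1)
    (hAn : ∀ (x : E) (M : ℝ), (∀ a ∈ A, ‖a x‖ ≤ M) → ‖x‖ ≤ M)
    {e : StrongDual ℂ E} (he : e ∈ extremePoints ℝ {e : StrongDual ℂ E | ‖e‖ ≤ 1}) :
    StrongDual.toWeakDual e ∈ A := by
  have hst : IsScalarTower ℝ ℂ (WeakDual ℂ E) :=
    ⟨fun r c a => DFunLike.ext _ _ fun x => smul_assoc r c (a x)⟩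
  have hlc : LocallyConvexSpace ℝ (WeakDual ℂ E) :=
    (WeakDual.withSeminorms ℂ E).toLocallyConvexSpace
  have hconvex : Convex ℝ (WeakDual.toStrongDual ⁻¹' closedBall (0 : StrongDual ℂ E) 1) :=
    fun x hx y hy a b ha hb hab => convex_closedBall (0 : StrongDual ℂ E) 1 hx hy ha hb hab
  refine @mem_of_mem_extremePoints_of_balanced ℂ (WeakDual ℂ E) _ _ _ _ hst _ _ _ hlc _ _ A
    (WeakDual.isCompact_closedBall 0 1) hconvex hA hA1 hAb (fun f u hf k hk => ?_) _
    ⟨mem_closedBall_zero_iff.2 he.1, fun y hy z hz hyz => congrArg StrongDual.toWeakDual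
      (he.2 (mem_closedBall_zero_iff.1 hy) (mem_closedBall_zero_iff.1 hz) hyz)⟩
  obtain ⟨x, hx⟩ := LinearMap.dualEmbedding_surjective (topDualPairing ℂ E) f
  have hfx (a : WeakDual ℂ E) : f a = a x := by rw [← hx]; rfl
  simp only [hfx] at hf ⊢
  have hkx : ‖k x‖ ≤ 1 * ‖x‖ :=
    (WeakDual.toStrongDual k).le_of_opNorm_le (mem_closedBall_zero_iff.1 hk) x
  exact hkx.trans ((one_mul _).trans_le (hAn x u hf))

open scoped ZeroAtInfty

variable {X : Type*} [TopologicalSpace X]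

theorem norm_zeroAtInfty_apply_le (g : C₀(X, ℂ)) (x : X) : ‖g x‖ ≤ ‖g‖ :=
  (g.toBCF.norm_coe_le_norm x).trans_eq g.norm_toBCF_eq_norm

/-- Evaluation of functions vanishing at infinity at the points of the one-point compactification;
evaluation at infinity is `0`. -/
noncomputable def onePointEval (o : OnePoint X) : StrongDual ℂ C₀(X, ℂ) :=
  o.elim 0 fun x => LinearMap.mkContinuous
    { toFun := fun g : C₀(X, ℂ) => g x
      map_add' := fun _ _ => rfl
      map_smul' := fun _ _ => rfl } 1 fun g =>
        (norm_zeroAtInfty_apply_le g x).trans_eq (one_mul _).symm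

theorem norm_onePointEval_apply_le (o : OnePoint X) (g : C₀(X, ℂ)) : ‖onePointEval o g‖ ≤ ‖g‖ := by
  induction o using OnePoint.rec with
  | infty => exact norm_zero.trans_le (norm_nonneg g)
  | coe x => exact norm_zeroAtInfty_apply_le g x

theorem continuous_onePointEval_apply [R1Space X] (g : C₀(X, ℂ)) :
    Continuous fun o : OnePoint X => onePointEval o g := by
  rw [OnePoint.continuous_iff, coclosedCompact_eq_cocompact]
  exact ⟨zero_at_infty g, map_continuous g⟩

theorem isCompact_image_smul_onePointEval_comp [R1Space X] (T : E →L[ℂ] C₀(X, ℂ)) :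
    IsCompact ((fun p : ℂ × OnePoint X =>
      p.1 • StrongDual.toWeakDual ((onePointEval p.2).comp T)) ''
        closedBall (0 : ℂ) 1 ×ˢ univ) := by
  have hcont : Continuous fun o : OnePoint X => StrongDual.toWeakDual ((onePointEval o).comp T) :=
    WeakDual.continuous_of_continuous_eval fun g => continuous_onePointEval_apply (T g)
  exact ((isCompact_closedBall _ _).prod isCompact_univ).image
    (continuous_fst.smul (hcont.comp continuous_snd))

theorem exists_eq_smul_onePointEval_comp [R1Space X] (T : E →ₗᵢ[ℂ] C₀(X, ℂ)) {e : StrongDual ℂ E}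
    (he : e ∈ extremePoints ℝ {e : StrongDual ℂ E | ‖e‖ ≤ 1}) :
    ∃ (c : ℂ) (o : OnePoint X), ‖c‖ ≤ 1 ∧
      e = c • (onePointEval o).comp T.toContinuousLinearMap := by
  have hmem := toWeakDual_mem_of_mem_extremePoints
    (isCompact_image_smul_onePointEval_comp T.toContinuousLinearMap) ?_ ?_ (fun g M hM => ?_) he
  · obtain ⟨⟨c, o⟩, ⟨hc, -⟩, hco⟩ := hmem
    exact ⟨c, o, mem_closedBall_zero_iff.1 hc, StrongDual.toWeakDual.injective hco.symm⟩
  · refine balanced_iff_smul_mem.2 fun c hc a ⟨⟨d, o⟩, ⟨hd, _⟩, hdo⟩ =>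
      ⟨(c * d, o), ⟨?_, mem_univ _⟩, ?_⟩
    · rw [mem_closedBall_zero_iff] at hd ⊢
      exact (norm_mul_le c d).trans (mul_le_one₀ hc (norm_nonneg d) hd)
    · rw [← hdo]
      exact DFunLike.ext _ _ fun g => mul_assoc c d _
  · rintro _ ⟨⟨d, o⟩, ⟨hd, -⟩, rfl⟩
    rw [mem_closedBall_zero_iff] at hd
    refine mem_closedBall_zero_iff.2
      (ContinuousLinearMap.opNorm_le_bound _ zero_le_one fun g => ?_)
    calc ‖d * onePointEval o (T g)‖ ≤ ‖d‖ * ‖onePointEval o (T g)‖ := norm_mul_le _ _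
      _ ≤ 1 * ‖g‖ := mul_le_mul hd
        ((norm_onePointEval_apply_le o (T g)).trans_eq (T.norm_map g)) (norm_nonneg _) zero_le_one
  · have hM (o : OnePoint X) : ‖onePointEval o (T g)‖ ≤ M := by
      simpa using hM _ ⟨(1, o), ⟨by simp, mem_univ o⟩, rfl⟩
    have hM0 : 0 ≤ M := (norm_nonneg _).trans (hM OnePoint.infty)
    rw [← T.norm_map g, ← ZeroAtInftyContinuousMap.norm_toBCF_eq_norm]
    exact (BoundedContinuousFunction.norm_le hM0).2 fun x => hM x

theorem exists_apply_eq_mul_of_mem_extremePoints [R1Space X] [Nontrivial E]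
    (T : E →ₗᵢ[ℂ] C₀(X, ℂ)) {e : StrongDual ℂ E}
    (he : e ∈ extremePoints ℝ {e : StrongDual ℂ E | ‖e‖ ≤ 1}) :
    ∃ (x : X) (c : ℂ), ‖c‖ = 1 ∧ ∀ g, e g = c * T g x := by
  have hnorm : ‖e‖ = 1 := norm_eq_one_of_mem_extremePoints he
  obtain ⟨c, o, hc, heq⟩ := exists_eq_smul_onePointEval_comp T he
  induction o using OnePoint.rec with
  | infty =>
    have h_zero : e = 0 := heq.trans (by ext; exact mul_zero c)
    simp [h_zero] at hnorm
  | coe x =>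
    have hbound : ‖e‖ ≤ ‖c‖ := by
      refine ContinuousLinearMap.opNorm_le_bound _ (norm_nonneg c) fun g => ?_
      rw [heq, ← T.norm_map g]
      exact (norm_mul_le c _).trans
        (mul_le_mul_of_nonneg_left (norm_zeroAtInfty_apply_le (T g) x) (norm_nonneg c))
    exact ⟨x, c, hc.antisymm (hnorm ▸ hbound), fun g => by rw [heq]; rfl⟩

end WeakDual

theorem mem_extremePoints_of_injective_of_mapsTo {E F : Type*} [AddCommGroup E] [Module ℝ E]
    [AddCommGroup F] [Module ℝ F] {f : E →ₗ[ℝ] F} (hf : Function.Injective f) {s : Set E}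
    {t : Set F} (hst : MapsTo f s t) {x : E} (hx : x ∈ s) (hfx : f x ∈ extremePoints ℝ t) :
    x ∈ extremePoints ℝ s :=
  ⟨hx, fun _ hy _ hz hxyz => hf (hfx.2 (hst hy) (hst hz)
    ((image_openSegment ℝ f.toAffineMap _ _).subset (mem_image_of_mem f hxyz)))⟩

end ExtremePoints

namespace Weight

open Bornology

variable {U V : Set ℂ} {v : Weight U} {w : Weight V}

theorem differentiableOn_coe (f : v.H₀) : DifferentiableOn ℂ (f : v.H) U :=
  (f : v.H).2.1

theorem apply_eq_zero_of_notMem (f : v.H₀) {z : ℂ} (hz : z ∉ U) : (f : v.H) z = 0 :=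
  (f : v.H).2.2.1 z hz

theorem ext_H₀ {f g : v.H₀} (h : ∀ z ∈ U, (f : v.H) z = (g : v.H) z) : f = g := by
  refine Subtype.ext (Subtype.ext (funext fun z => ?_))
  by_cases hz : z ∈ U
  · exact h z hz
  · exact (apply_eq_zero_of_notMem f hz).trans (apply_eq_zero_of_notMem g hz).symm

/-- The element of `H₀` given by a holomorphic function on `U` satisfying the vanishing condition.
That condition already makes `v * ‖f‖` bounded, so no bound is required; the values of `f` outside
`U` are discarded. -/
noncomputable def mkH₀ (v : Weight U) (f : ℂ → ℂ) (hf : DifferentiableOn ℂ f U)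
    (hv : ∀ ε > 0, ∃ K ⊆ U, IsCompact K ∧ ∀ z ∈ U \ K, v z * ‖f z‖ < ε) : v.H₀ :=
  ⟨⟨U.indicator f, hf.congr fun z hz => indicator_of_mem hz f,
    fun z hz => indicator_of_notMem hz f, by
      obtain ⟨K, hKU, hK, hK1⟩ := hv 1 one_pos
      obtain ⟨C, hC⟩ := (hK.image_of_continuousOn (f := fun z => v z * ‖f z‖)
        ((v.continuousOn.mono hKU).mul (hf.continuousOn.mono hKU).norm)).bddAbove
      refine ⟨max C 1, fun z hz => ?_⟩
      rw [indicator_of_mem hz]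
      by_cases hzK : z ∈ K
      · exact (hC (mem_image_of_mem _ hzK)).trans (le_max_left _ _)
      · exact (hK1 z ⟨hz, hzK⟩).le.trans (le_max_right _ _)⟩, fun ε hε => by
    obtain ⟨K, hKU, hK, hKε⟩ := hv ε hε
    exact ⟨K, hKU, hK, fun z hz => by simpa [indicator_of_mem hz.1] using hKε z hz⟩⟩

theorem mkH₀_apply {f : ℂ → ℂ} {hf : DifferentiableOn ℂ f U}
    {hv : ∀ ε > 0, ∃ K ⊆ U, IsCompact K ∧ ∀ z ∈ U \ K, v z * ‖f z‖ < ε} {z : ℂ} (hz : z ∈ U) :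
    (v.mkH₀ f hf hv : v.H) z = f z :=
  indicator_of_mem hz f

/-- Multiplication by the coordinate function, `f ↦ (z ↦ z f(z))`, as an operator on `H₀`. -/
noncomputable def mulId (v : Weight U) (hU : IsBounded U) : Module.End ℂ v.H₀ where
  toFun f := v.mkH₀ (fun z => z * (f : v.H) z) (differentiableOn_id.mul (differentiableOn_coe f))
    fun ε hε => by
      obtain ⟨R, hR, hUR⟩ := hU.exists_pos_norm_le
      obtain ⟨K, hKU, hK, hKε⟩ := f.2 (ε / R) (div_pos hε hR)
      refine ⟨K, hKU, hK, fun z hz => ?_⟩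
      calc v z * ‖z * (f : v.H) z‖ = ‖z‖ * (v z * ‖(f : v.H) z‖) := by
            rw [norm_mul, mul_left_comm]
        _ ≤ R * (v z * ‖(f : v.H) z‖) := mul_le_mul_of_nonneg_right (hUR z hz.1)
            (mul_nonneg (v.pos z hz.1).le (norm_nonneg _))
        _ < ε := (lt_div_iff₀' hR).1 (hKε z hz)
  map_add' f g := ext_H₀ fun z hz => by simp [mkH₀_apply hz, mul_add]
  map_smul' c f := ext_H₀ fun z hz => by simp [mkH₀_apply hz, mul_left_comm]

variable (hU : IsBounded U)

theorem mulId_apply (f : v.H₀) (z : ℂ) : (v.mulId hU f : v.H) z = z * (f : v.H) z := by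
  by_cases hz : z ∈ U
  · exact indicator_of_mem hz fun z => z * (f : v.H) z
  · rw [apply_eq_zero_of_notMem _ hz, apply_eq_zero_of_notMem _ hz, mul_zero]

theorem mulId_pow_apply (n : ℕ) (f : v.H₀) (z : ℂ) :
    ((v.mulId hU ^ n) f : v.H) z = z ^ n * (f : v.H) z := by
  induction n with
  | zero => rw [pow_zero, pow_zero, one_mul, Module.End.one_apply]
  | succ n ih => rw [pow_succ', Module.End.mul_apply, mulId_apply, ih, pow_succ', mul_assoc]

theorem eq_of_forall_mul_apply_eq (hU : IsBounded U) {a b c d : ℂ}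
    (hne : ∃ g : v.H₀, c * (g : v.H) a ≠ 0)
    (h : ∀ g : v.H₀, c * (g : v.H) a = d * (g : v.H) b) : a = b := by
  obtain ⟨g, hg⟩ := hne
  refine mul_right_cancel₀ hg ?_
  calc a * (c * (g : v.H) a) = c * (v.mulId hU g : v.H) a := by rw [mulId_apply, mul_left_comm]
    _ = d * (v.mulId hU g : v.H) b := h _
    _ = b * (c * (g : v.H) a) := by rw [mulId_apply, mul_left_comm, h g]

theorem exists_isCompact_closedBall_inter {b : ℂ} (hb : b ∉ frontier U) :
    ∃ r > 0, IsCompact (closedBall b r ∩ U) := by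
  by_cases hbU : b ∈ interior U
  · obtain ⟨r, hr, hrU⟩ := nhds_basis_closedBall.mem_iff.1 (mem_interior_iff_mem_nhds.1 hbU)
    exact ⟨r, hr, by rw [inter_eq_left.2 hrU]; exact isCompact_closedBall b r⟩
  · have hbc : (closure U)ᶜ ∈ 𝓝 b :=
      isClosed_closure.isOpen_compl.mem_nhds fun hbc => hb ⟨hbc, hbU⟩
    obtain ⟨r, hr, hrU⟩ := nhds_basis_closedBall.mem_iff.1 hbc
    have hempty : closedBall b r ∩ U = ∅ :=
      disjoint_iff_inter_eq_empty.1 (disjoint_left.2 fun z hz hzU => hrU hz (subset_closure hzU))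
    exact ⟨r, hr, hempty ▸ isCompact_empty⟩

theorem exists_eq_sub_mul (f : v.H₀) {b : ℂ} (hb : b ∉ frontier U) (hfb : (f : v.H) b = 0) :
    ∃ k : v.H₀, ∀ z ∈ U, (f : v.H) z = (z - b) * (k : v.H) z := by
  have hdslope (z : ℂ) : (f : v.H) z = (z - b) * dslope (f : v.H) b z := by
    simpa [hfb] using (sub_smul_dslope (f : v.H) b z).symm
  have hdiff : DifferentiableOn ℂ (dslope (f : v.H) b) U := by
    by_cases hbU : b ∈ U
    · have hnhds : U ∈ 𝓝 b := mem_interior_iff_mem_nhds.1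
        (by_contra fun hbi => hb ⟨subset_closure hbU, hbi⟩)
      exact (Complex.differentiableOn_dslope hnhds).2 (differentiableOn_coe f)
    · exact (differentiableOn_dslope_of_notMem hbU).2 (differentiableOn_coe f)
  obtain ⟨r, hr, hrU⟩ := exists_isCompact_closedBall_inter hb
  refine ⟨v.mkH₀ (dslope (f : v.H) b) hdiff fun ε hε => ?_,
    fun z hz => by rw [mkH₀_apply hz, ← hdslope]⟩
  obtain ⟨K, hKU, hK, hKε⟩ := f.2 (r * ε) (mul_pos hr hε)
  refine ⟨K ∪ closedBall b r ∩ U, union_subset hKU inter_subset_right, hK.union hrU,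
    fun z hz => ?_⟩
  have hzr : r < ‖z - b‖ :=
    not_le.1 fun hzb => hz.2 (Or.inr ⟨mem_closedBall_iff_norm.2 hzb, hz.1⟩)
  refine lt_of_mul_lt_mul_left
    (lt_of_le_of_lt ?_ (hKε z ⟨hz.1, fun hzK => hz.2 (Or.inl hzK)⟩)) hr.le
  calc r * (v z * ‖dslope (f : v.H) b z‖) ≤ ‖z - b‖ * (v z * ‖dslope (f : v.H) b z‖) :=
        mul_le_mul_of_nonneg_right hzr.le (mul_nonneg (v.pos z hz.1).le (norm_nonneg _))
    _ = v z * ‖(f : v.H) z‖ := by rw [hdslope z, norm_mul, mul_left_comm]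

section Eigenfunctional

variable {hU} {ℓ : v.H₀ →ₗ[ℂ] ℂ} {b : ℂ}

theorem map_eq_zero_of_apply_eq_zero (hℓ : ∀ g, ℓ (v.mulId hU g) = b * ℓ g) (hb : b ∉ frontier U)
    {g : v.H₀} (hg : (g : v.H) b = 0) : ℓ g = 0 := by
  obtain ⟨k, hk⟩ := exists_eq_sub_mul g hb hg
  have hgk : g = v.mulId hU k - b • k := by
    refine eq_sub_of_add_eq (ext_H₀ fun z hz => ?_)
    change (g : v.H) z + b * (k : v.H) z = (v.mulId hU k : v.H) z
    rw [hk z hz, mulId_apply]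
    ring
  rw [hgk, map_sub, hℓ, map_smul, smul_eq_mul, sub_self]

theorem apply_mul_map_eq (hℓ : ∀ g, ℓ (v.mulId hU g) = b * ℓ g) (hb : b ∉ frontier U)
    (f g : v.H₀) : (f : v.H) b * ℓ g = (g : v.H) b * ℓ f := by
  have hvanish : (((f : v.H) b • g - (g : v.H) b • f : v.H₀) : v.H) b = 0 := by
    rw [sub_eq_add_neg, ← neg_smul]
    change (f : v.H) b * (g : v.H) b + -(g : v.H) b * (f : v.H) b = 0
    ring
  have hmap := map_eq_zero_of_apply_eq_zero hℓ hb hvanish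
  rwa [map_sub, map_smul, map_smul, sub_eq_zero] at hmap

theorem map_eq_zero_of_notMem_closure (hℓ : ∀ g, ℓ (v.mulId hU g) = b * ℓ g) (hb : b ∉ closure U)
    (g : v.H₀) : ℓ g = 0 :=
  map_eq_zero_of_apply_eq_zero hℓ (fun hbf => hb hbf.1)
    (apply_eq_zero_of_notMem g fun hbU => hb (subset_closure hbU))

end Eigenfunctional

open scoped ZeroAtInfty

/-- The isometric embedding `f ↦ v * f` of `H₀` into the continuous functions vanishing at
infinity. -/
noncomputable def toC₀ (v : Weight U) : v.H₀ →ₗᵢ[ℂ] C₀(U, ℂ) where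
  toFun f :=
    { toFun := fun z => v z * (f : v.H) z
      continuous_toFun := continuousOn_iff_continuous_domRestrict.1
        ((Complex.continuous_ofReal.comp_continuousOn v.continuousOn).mul
          (differentiableOn_coe f).continuousOn)
      zero_at_infty' := by
        refine tendsto_zero_iff_norm_tendsto_zero.2 (Metric.tendsto_nhds.2 fun ε hε => ?_)
        obtain ⟨K, hKU, hK, hKε⟩ := f.2 ε hε
        have hK' : IsCompact ((↑) ⁻¹' K : Set U) := by
          rwa [Subtype.isCompact_iff, image_preimage_eq_inter_range, Subtype.range_coe,
            inter_eq_left.2 hKU]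
        filter_upwards [hK'.compl_mem_cocompact] with z hz
        simpa [abs_of_pos (v.pos z z.2)] using hKε z ⟨z.2, hz⟩ }
  map_add' f g := by ext z; exact mul_add _ _ _
  map_smul' c f := by ext z; exact mul_left_comm _ _ _
  norm_map' f := by
    rw [← ZeroAtInftyContinuousMap.norm_toBCF_eq_norm, BoundedContinuousFunction.norm_eq_iSup_norm]
    refine iSup_congr fun z => ?_
    change ‖(v z : ℂ) * (f : v.H) z‖ = v z * ‖(f : v.H) z‖
    rw [norm_mul, Complex.norm_of_nonneg (v.pos z z.2).le]

theorem exists_apply_ne_zero [Nontrivial v.H₀] {a : ℂ} (ha : a ∈ v.boundary) :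
    ∃ g : v.H₀, (g : v.H) a ≠ 0 := by
  obtain ⟨haU, hext⟩ := ha
  by_contra! hzero
  have hδ : (v a : ℂ) • (v.eval ⟨a, haU⟩).comp v.H₀.subtypeL = 0 :=
    ContinuousLinearMap.ext fun g => (congrArg _ (hzero g)).trans (mul_zero _)
  rw [hδ] at hext
  exact zero_ne_one (norm_zero.symm.trans (norm_eq_one_of_mem_extremePoints hext))

theorem exists_mem_forall_apply_eq_mul [Nontrivial v.H₀] (T : v.H₀ →ₗᵢ[ℂ] w.H₀) {a : ℂ}
    (ha : a ∈ v.boundary) : ∃ z ∈ V, ∃ κ : ℂ, w z * ‖κ‖ = v a ∧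
      ∀ g : v.H₀, (T g : w.H) z = κ * (g : v.H) a := by
  obtain ⟨haU, hext⟩ := ha
  obtain ⟨z, c, hc, hg⟩ := exists_apply_eq_mul_of_mem_extremePoints (w.toC₀.comp T) hext
  have hg (g : v.H₀) : (v a : ℂ) * (g : v.H) a = c * (w z * (T g : w.H) z) := hg g
  have hwz : 0 < w z := w.pos z z.2
  have hwz' : (w z : ℂ) ≠ 0 := Complex.ofReal_ne_zero.2 hwz.ne'
  have hc0 : c ≠ 0 := norm_ne_zero_iff.1 (hc ▸ one_ne_zero)
  refine ⟨z, z.2, v a / (c * w z), ?_, fun g => ?_⟩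
  · rw [norm_div, norm_mul, hc, one_mul, Complex.norm_of_nonneg hwz.le,
      Complex.norm_of_nonneg (v.pos a haU).le, mul_div_cancel₀ _ hwz.ne']
  · rw [div_mul_eq_mul_div, hg, ← mul_assoc, mul_div_cancel_left₀ _ (mul_ne_zero hc0 hwz')]

end Weight

section Analytic

theorem eqOn_of_eqOn_of_not_countable {f g : ℂ → ℂ} {V S : Set ℂ} (hf : AnalyticOnNhd ℂ f V)
    (hg : AnalyticOnNhd ℂ g V) (hV : IsPreconnected V) (hSV : S ⊆ V) (hS : ¬ S.Countable)
    (h : EqOn f g S) : EqOn f g V := by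
  obtain ⟨z, hz, hzS⟩ : ∃ z ∈ S, AccPt z (𝓟 S) := by
    by_contra! hno
    have : DiscreteTopology S := discreteTopology_of_noAccPts hno
    exact hS (countable_coe_iff.1 (TopologicalSpace.separableSpace_iff_countable.1 inferInstance))
  exact hf.eqOn_of_preconnected_of_frequently_eq hg hV (hSV hz)
    ((accPt_iff_frequently_nhdsNE.1 hzS).mono fun y hy => h hy)

theorem isMeagre_of_countable {X : Type*} [TopologicalSpace X] [T1Space X]
    [∀ x : X, NeBot (𝓝[≠] x)] {s : Set X} (hs : s.Countable) : IsMeagre s := by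
  have hnd (x : X) : IsNowhereDense {x} :=
    isClosed_singleton.isNowhereDense_iff.2 (interior_singleton x)
  rw [← biUnion_of_singleton s]
  exact isMeagre_biUnion hs fun x _ => (hnd x).isMeagre

theorem not_countable_of_isOpen {U : Set ℂ} (hU : IsOpen U) (hU₀ : U.Nonempty) : ¬ U.Countable :=
  fun hc => not_isMeagre_of_isOpen hU hU₀ (isMeagre_of_countable hc)

theorem le_of_forall_nsmul_le_succ_nsmul {a b : ℕ∞} (hb : b ≠ ⊤)
    (h : ∀ n : ℕ, n • b ≤ (n + 1) • a) : b ≤ a := by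
  induction a with
  | top => exact le_top
  | coe a =>
    lift b to ℕ using hb
    have hn : (a + 1) * b ≤ (a + 1 + 1) * a := by
      have := h (a + 1)
      rw [nsmul_eq_mul, nsmul_eq_mul] at this
      exact_mod_cast this
    refine Nat.cast_le.2 (not_lt.1 fun hab => ?_)
    nlinarith

theorem analyticOrderAt_le_of_forall_mul_pow_eq {f g : ℂ → ℂ} {F : ℕ → ℂ → ℂ} {z : ℂ}
    (hf : AnalyticAt ℂ f z) (hg : AnalyticAt ℂ g z) (hF : ∀ n, AnalyticAt ℂ (F n) z)
    (hfz : analyticOrderAt f z ≠ ⊤) (h : ∀ n, F n * f ^ n =ᶠ[𝓝 z] g ^ (n + 1)) :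
    analyticOrderAt f z ≤ analyticOrderAt g z := by
  refine le_of_forall_nsmul_le_succ_nsmul hfz fun n => ?_
  calc n • analyticOrderAt f z ≤ analyticOrderAt (F n) z + n • analyticOrderAt f z :=
        le_add_self
    _ = analyticOrderAt (F n * f ^ n) z := by
        rw [analyticOrderAt_mul (hF n) (hf.pow n), analyticOrderAt_pow hf]
    _ = (n + 1) • analyticOrderAt g z := by
        rw [analyticOrderAt_congr (h n), analyticOrderAt_pow hg]

theorem map_natCast_sub_map_natCast_nonneg {a b : ℕ∞} (hb : b ≠ ⊤) (hba : b ≤ a) :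
    (0 : WithTop ℤ) ≤ a.map (↑) - b.map (↑) := by
  lift b to ℕ using hb
  induction a with
  | top => exact le_top
  | coe a =>
    rw [ENat.map_natCast, ENat.map_natCast]
    exact WithTop.coe_le_coe.2 (sub_nonneg.2 (Int.ofNat_le.2 (Nat.cast_le.1 hba)))

theorem exists_analyticOnNhd_eqOn_mul {f g : ℂ → ℂ} {V : Set ℂ} (hf : AnalyticOnNhd ℂ f V)
    (hg : AnalyticOnNhd ℂ g V) (hgz : ∀ z ∈ V, analyticOrderAt g z ≠ ⊤)
    (hle : ∀ z ∈ V, analyticOrderAt g z ≤ analyticOrderAt f z) :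
    ∃ φ, AnalyticOnNhd ℂ φ V ∧ EqOn f (φ * g) V := by
  have hmero : MeromorphicOn (f / g) V := hf.meromorphicOn.div hg.meromorphicOn
  have hφ : AnalyticOnNhd ℂ (toMeromorphicNFOn (f / g) V) V := fun z hz => by
    rw [← (meromorphicNFOn_toMeromorphicNFOn (f / g) V
        hz).meromorphicOrderAt_nonneg_iff_analyticAt, meromorphicOrderAt_toMeromorphicNFOn hmero hz,
      meromorphicOrderAt_div (hf z hz).meromorphicAt (hg z hz).meromorphicAt,
      (hf z hz).meromorphicOrderAt_eq, (hg z hz).meromorphicOrderAt_eq]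
    exact map_natCast_sub_map_natCast_nonneg (hgz z hz) (hle z hz)
  refine ⟨_, hφ, fun z hz => ?_⟩
  have hgne : ∀ᶠ y in 𝓝[≠] z, g y ≠ 0 :=
    (hg z hz).eventually_eq_zero_or_eventually_ne_zero.resolve_left
      (mt analyticOrderAt_eq_top.2 (hgz z hz))
  have hNE : f =ᶠ[𝓝[≠] z] toMeromorphicNFOn (f / g) V * g := by
    filter_upwards [hmero.toMeromorphicNFOn_eq_self_on_nhdsNE hz, hgne] with y hy hgy
    rw [Pi.mul_apply, hy, Pi.div_apply, div_mul_cancel₀ _ hgy]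
  exact (((hf z hz).continuousAt.eventuallyEq_nhds_iff_eventuallyEq_nhdsNE
    ((hφ z hz).mul (hg z hz)).continuousAt).1 hNE).eq_of_nhds

theorem image_eq_of_subset_closure {φ : ℂ → ℂ} {U V : Set ℂ} (hφ : AnalyticOnNhd ℂ φ V)
    (hVo : IsOpen V) (hV : IsPreconnected V) (hU : interior (closure U) = U) (hU₀ : U.Nonempty)
    (hUφ : U ⊆ φ '' V) (hφU : φ '' V ⊆ closure U) : φ '' V = U := by
  have hUo : IsOpen U := hU ▸ isOpen_interior
  refine Subset.antisymm ?_ hUφ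
  rcases hφ.is_constant_or_isOpen hV with ⟨c, hc⟩ | hopen
  · have hφc : φ '' V ⊆ {c} := image_subset_iff.2 hc
    exact absurd ((countable_singleton c).mono (hUφ.trans hφc)) (not_countable_of_isOpen hUo hU₀)
  · exact hU ▸ (hopen V Subset.rfl hVo).subset_interior_iff.2 hφU

end Analytic

namespace Weight

open Bornology

variable {U V : Set ℂ} {v : Weight U} {w : Weight V} {hU : IsBounded U}

/-- Point evaluation as a linear functional on `H₀`. -/
def evalLinear (v : Weight U) (z : ℂ) : v.H₀ →ₗ[ℂ] ℂ :=
  LinearMap.proj z ∘ₗ v.HSubmodule.subtype ∘ₗ v.H₀.subtype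

theorem exists_forall_map_mulId_eq {T : v.H₀ → w.H₀} {S : Set ℂ} (hVo : IsOpen V)
    (hV : IsPreconnected V) (hSV : S ⊆ V) (hS : ¬ S.Countable)
    (hT : ∀ z ∈ S, ∃ a κ : ℂ, ∀ g : v.H₀, (T g : w.H) z = κ * (g : v.H) a)
    (hne : ∃ f, ∃ z ∈ V, (T f : w.H) z ≠ 0) :
    ∃ φ, AnalyticOnNhd ℂ φ V ∧
      ∀ g, ∀ z ∈ V, (T (v.mulId hU g) : w.H) z = φ z * (T g : w.H) z := by
  obtain ⟨f, z₀, hz₀, hfz₀⟩ := hne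
  have hTan (g : v.H₀) : AnalyticOnNhd ℂ (T g : w.H) V :=
    (differentiableOn_coe (T g)).analyticOnNhd hVo
  have hpow (n : ℕ) : EqOn ((T ((v.mulId hU ^ (n + 1)) f) : w.H) * (T f : w.H) ^ n : ℂ → ℂ)
      ((T (v.mulId hU f) : w.H) ^ (n + 1) : ℂ → ℂ) V := by
    refine eqOn_of_eqOn_of_not_countable ((hTan _).mul ((hTan f).pow n)) ((hTan _).pow (n + 1))
      hV hSV hS fun z hz => ?_
    obtain ⟨a, κ, hκ⟩ := hT z hz
    simp only [Pi.mul_apply, Pi.pow_apply, hκ, mulId_apply, mulId_pow_apply]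
    ring
  have hcross (g : v.H₀) : EqOn ((T (v.mulId hU g) : w.H) * (T f : w.H) : ℂ → ℂ)
      ((T (v.mulId hU f) : w.H) * (T g : w.H) : ℂ → ℂ) V := by
    refine eqOn_of_eqOn_of_not_countable ((hTan _).mul (hTan _)) ((hTan _).mul (hTan _))
      hV hSV hS fun z hz => ?_
    obtain ⟨a, κ, hκ⟩ := hT z hz
    simp only [Pi.mul_apply, hκ, mulId_apply]
    ring
  have hfinite : ∀ z ∈ V, analyticOrderAt (T f : w.H) z ≠ ⊤ := fun z hz =>
    (hTan f).analyticOrderAt_ne_top_of_isPreconnected hV hz₀ hz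
      (((hTan f z₀ hz₀).analyticOrderAt_eq_zero.2 hfz₀).trans_ne ENat.zero_ne_top)
  have hle : ∀ z ∈ V, analyticOrderAt (T f : w.H) z ≤ analyticOrderAt (T (v.mulId hU f) : w.H) z :=
    fun z hz => analyticOrderAt_le_of_forall_mul_pow_eq (hTan _ z hz) (hTan _ z hz)
      (fun n => hTan _ z hz) (hfinite z hz)
      fun n => (hpow n).eventuallyEq_of_mem (hVo.mem_nhds hz)
  obtain ⟨φ, hφ, hfφ⟩ := exists_analyticOnNhd_eqOn_mul (hTan _) (hTan _) hfinite hle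
  refine ⟨φ, hφ, fun g z hz => ?_⟩
  have hzero := AnalyticOnNhd.eq_zero_or_eq_zero_of_mul_eq_zero
    ((hTan (v.mulId hU g)).sub (hφ.mul (hTan g))) (hTan f) (fun z hz => ?_) hV
  · exact sub_eq_zero.1 (hzero.resolve_right (fun h => hfz₀ (h z₀ hz₀)) z hz)
  · have h₁ := hcross g hz
    have h₂ := hfφ hz
    simp only [Pi.mul_apply, Pi.sub_apply] at h₁ h₂ ⊢
    rw [sub_mul, h₁, h₂]
    ring

variable {T : v.H₀ →ₗ[ℂ] w.H₀} {φ : ℂ → ℂ}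

theorem image_subset_closure (hVo : IsOpen V) (hV : IsPreconnected V)
    (hT : ∀ g, ∀ z ∈ V, (T (v.mulId hU g) : w.H) z = φ z * (T g : w.H) z)
    (hφ : ContinuousOn φ V) (hne : ∃ f, ∃ z ∈ V, (T f : w.H) z ≠ 0) :
    φ '' V ⊆ closure U := by
  rintro _ ⟨z, hz, rfl⟩
  by_contra hφz
  obtain ⟨f, z₀, hz₀, hfz₀⟩ := hne
  have hvanish : (T f : w.H) =ᶠ[𝓝 z] 0 := by
    filter_upwards [hVo.mem_nhds hz, (hφ.continuousAt (hVo.mem_nhds hz)).eventually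
      (isClosed_closure.isOpen_compl.mem_nhds hφz)] with y hy hφy
    exact map_eq_zero_of_notMem_closure (ℓ := w.evalLinear y ∘ₗ T) (fun g => hT g y hy) hφy f
  exact hfz₀ (((differentiableOn_coe (T f)).analyticOnNhd
    hVo).eqOn_zero_of_preconnected_of_eventuallyEq_zero hV hz hvanish hz₀)

theorem exists_differentiableOn_eq_mul_comp (hUo : IsOpen U) (hVo : IsOpen V)
    (hT : ∀ g, ∀ z ∈ V, (T (v.mulId hU g) : w.H) z = φ z * (T g : w.H) z)
    (hφ : DifferentiableOn ℂ φ V) (hφU : MapsTo φ V U)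
    (hne : ∀ a ∈ U, ∃ g : v.H₀, (g : v.H) a ≠ 0) :
    ∃ h : ℂ → ℂ, DifferentiableOn ℂ h V ∧
      ∀ g : v.H₀, ∀ z ∈ V, (T g : w.H) z = h z * (g : v.H) (φ z) := by
  choose! G hG using hne
  set h : ℂ → ℂ := fun z => (T (G (φ z)) : w.H) z / (G (φ z) : v.H) (φ z)
  have happ (g : v.H₀) (z : ℂ) (hz : z ∈ V) : (T g : w.H) z = h z * (g : v.H) (φ z) := by
    have hφz : φ z ∉ frontier U :=
      disjoint_left.1 (disjoint_frontier_iff_isOpen.2 hUo).symm (hφU hz)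
    rw [div_mul_eq_mul_div, eq_div_iff (hG _ (hφU hz)), mul_comm, mul_comm _ ((g : v.H) _)]
    exact apply_mul_map_eq (ℓ := w.evalLinear z ∘ₗ T) (fun g => hT g z hz) hφz _ g
  refine ⟨h, fun z hz => ?_, happ⟩
  set g := G (φ z)
  have hg0 : (g : v.H) (φ z) ≠ 0 := hG _ (hφU hz)
  have hgφ : DifferentiableAt ℂ (fun y => (g : v.H) (φ y)) z :=
    ((differentiableOn_coe g).differentiableAt (hUo.mem_nhds (hφU hz))).comp z
      (hφ.differentiableAt (hVo.mem_nhds hz))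
  have hquot : h =ᶠ[𝓝 z] fun y => (T g : w.H) y / (g : v.H) (φ y) := by
    filter_upwards [hVo.mem_nhds hz, hgφ.continuousAt.eventually_ne hg0] with y hy hy0
    rw [happ g y hy, mul_div_cancel_right₀ _ hy0]
  exact ((((differentiableOn_coe (T g)).differentiableAt (hVo.mem_nhds hz)).fun_div hgφ
    hg0).congr_of_eventuallyEq hquot).differentiableWithinAt

theorem nonempty_of_nontrivial [Nontrivial v.H₀] : U.Nonempty := by
  obtain ⟨f, g, hfg⟩ := exists_pair_ne v.H₀
  by_contra! hU₀
  exact hfg (ext_H₀ fun z hz => absurd hz (hU₀ ▸ notMem_empty z))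

theorem exists_injOn_forall_apply_eq_mul [Nontrivial v.H₀] (hUb : IsBounded U)
    (hv : v.IsComplete) (T : v.H₀ →ₗᵢ[ℂ] w.H₀) :
    ∃ Z κ : ℂ → ℂ, MapsTo Z U V ∧ InjOn Z U ∧ (∀ a ∈ U, κ a ≠ 0) ∧
      ∀ a ∈ U, ∀ g : v.H₀, (T g : w.H) (Z a) = κ a * (g : v.H) a := by
  choose! Z hZ κ hκ hTZ using fun a (ha : a ∈ U) =>
    exists_mem_forall_apply_eq_mul T (hv.symm ▸ ha : a ∈ v.boundary)
  have hκ0 : ∀ a ∈ U, κ a ≠ 0 := fun a ha h0 =>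
    (v.pos a ha).ne (by rw [← hκ a ha, h0, norm_zero, mul_zero])
  refine ⟨Z, κ, hZ, fun a ha b hb hab => ?_, hκ0, hTZ⟩
  obtain ⟨g, hg⟩ := exists_apply_ne_zero (hv.symm ▸ ha : a ∈ v.boundary)
  exact eq_of_forall_mul_apply_eq hUb ⟨g, mul_ne_zero (hκ0 a ha) hg⟩ fun f =>
    (hTZ a ha f).symm.trans ((congrArg _ hab).trans (hTZ b hb f))

theorem exists_induces [Nontrivial v.H₀] (hUb : IsBounded U) (hU : interior (closure U) = U)
    (hVo : IsOpen V) (hV : IsPreconnected V) (hv : v.IsComplete) (T : v.H₀ →ₗᵢ[ℂ] w.H₀) :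
    ∃ φ h, Induces T φ h := by
  have hUo : IsOpen U := hU ▸ isOpen_interior
  have hU₀ : U.Nonempty := nonempty_of_nontrivial (v := v)
  have hne : ∀ a ∈ U, ∃ g : v.H₀, (g : v.H) a ≠ 0 :=
    fun a ha => exists_apply_ne_zero (hv.symm ▸ ha : a ∈ v.boundary)
  obtain ⟨Z, κ, hZ, hZinj, hκ, hTZ⟩ := exists_injOn_forall_apply_eq_mul hUb hv T
  have hTne : ∀ a ∈ U, ∃ g, (T g : w.H) (Z a) ≠ 0 := fun a ha =>
    (hne a ha).imp fun g hg => by rw [hTZ a ha]; exact mul_ne_zero (hκ a ha) hg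
  have hTne' : ∃ g, ∃ z ∈ V, (T g : w.H) z ≠ 0 := by
    obtain ⟨a, ha⟩ := hU₀
    exact (hTne a ha).imp fun g hg => ⟨Z a, hZ ha, hg⟩
  obtain ⟨φ, hφ, hTφ⟩ := exists_forall_map_mulId_eq (hU := hUb) (T := T) hVo hV hZ.image_subset
    (fun hc => not_countable_of_isOpen hUo hU₀ (countable_of_injective_of_countable_image hZinj hc))
    (forall_mem_image.2 fun a ha => ⟨a, κ a, hTZ a ha⟩) hTne'
  have hUφ : U ⊆ φ '' V := fun a ha => by
    obtain ⟨g, hg⟩ := hTne a ha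
    refine ⟨Z a, hZ ha, mul_right_cancel₀ hg ?_⟩
    rw [← hTφ g _ (hZ ha), hTZ a ha, hTZ a ha, mulId_apply, mul_left_comm]
  have himage : φ '' V = U := image_eq_of_subset_closure hφ hVo hV hU hU₀ hUφ
    (image_subset_closure (T := T.toLinearMap) hVo hV hTφ hφ.continuousOn hTne')
  obtain ⟨h, hh, hTh⟩ := exists_differentiableOn_eq_mul_comp (T := T.toLinearMap) hUo hVo hTφ
    hφ.differentiableOn (mapsTo_iff_image_subset.2 himage.subset) hne
  exact ⟨φ, h, hφ.differentiableOn, himage, hh, hTh⟩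

end Weight

section Meagre

theorem countable_image_of_eventually_eq {X Y : Type*} [TopologicalSpace X]
    [SecondCountableTopology X] {f : X → Y} {s : Set X} (h : ∀ x ∈ s, ∀ᶠ y in 𝓝[s] x, f y = f x) :
    (f '' s).Countable := by
  obtain ⟨t, -, ht, hst⟩ := TopologicalSpace.countable_cover_nhdsWithin h
  refine (ht.image f).mono (image_subset_iff.2 fun y hy => ?_)
  obtain ⟨x, hx, hyx⟩ := mem_iUnion₂.1 (hst hy)
  exact ⟨x, hx, hyx.symm⟩

theorem isMeagre_image_of_forall_nhdsWithin {X Y : Type*} [TopologicalSpace X]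
    [SecondCountableTopology X] [TopologicalSpace Y] {f : X → Y} {s : Set X}
    (h : ∀ x ∈ s, ∃ t ∈ 𝓝[s] x, IsMeagre (f '' t)) : IsMeagre (f '' s) := by
  choose! t ht hft using h
  obtain ⟨c, hcs, hc, hsc⟩ := TopologicalSpace.countable_cover_nhdsWithin ht
  refine (isMeagre_biUnion hc fun x hx => hft x (hcs hx)).mono ?_
  rw [← image_iUnion₂]
  exact image_mono hsc

theorem isMeagre_image_inter_source {X Y : Type*} [TopologicalSpace X] [TopologicalSpace Y]
    (e : OpenPartialHomeomorph X Y) {s : Set X} (hs : IsMeagre s) :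
    IsMeagre (e '' (s ∩ e.source)) := by
  rw [← image_domRestrict]
  exact e.isOpenEmbedding_restrict.isInducing.isMeagre_image
    (hs.preimage_of_isOpenMap continuous_subtype_val e.open_source.isOpenMap_subtype_val)

variable {φ : ℂ → ℂ} {V : Set ℂ}

theorem countable_image_setOf_deriv_eq_zero (hφ : AnalyticOnNhd ℂ φ V) :
    (φ '' {z ∈ V | deriv φ z = 0}).Countable := by
  refine countable_image_of_eventually_eq fun z hz => ?_
  rcases (hφ z hz.1).deriv.eventually_eq_zero_or_eventually_ne_zero with hderiv | hderiv
  · obtain ⟨r, hr, hball⟩ := Metric.mem_nhds_iff.1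
      ((hφ z hz.1).eventually_analyticAt.and hderiv)
    refine mem_nhdsWithin_of_mem_nhds (mem_of_superset (ball_mem_nhds z hr) fun y hy => ?_)
    exact isOpen_ball.is_const_of_deriv_eq_zero (convex_ball z r).isPreconnected
      (fun x hx => (hball hx).1.differentiableAt.differentiableWithinAt) (fun x hx => (hball hx).2)
      hy (mem_ball_self hr)
  · filter_upwards [mem_nhdsWithin_of_mem_nhds (eventually_nhdsWithin_iff.1 hderiv),
      self_mem_nhdsWithin] with y hy hyz
    by_contra hne
    exact hy (fun hyz => hne (congrArg φ hyz)) hyz.2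

theorem isMeagre_image_of_analyticOnNhd (hφ : AnalyticOnNhd ℂ φ V) {A : Set ℂ} (hA : IsMeagre A)
    (hAV : A ⊆ V) : IsMeagre (φ '' A) := by
  have hregular : IsMeagre (φ '' {z ∈ A | deriv φ z ≠ 0}) := by
    refine isMeagre_image_of_forall_nhdsWithin fun z hz => ?_
    have hinv := (hφ z (hAV hz.1)).hasStrictDerivAt.hasStrictFDerivAt_equiv hz.2
    exact ⟨_, inter_mem_nhdsWithin _ ((hinv.toOpenPartialHomeomorph φ).open_source.mem_nhds
        hinv.mem_toOpenPartialHomeomorph_source),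
      isMeagre_image_inter_source (hinv.toOpenPartialHomeomorph φ) (hA.mono (sep_subset _ _))⟩
  refine ((isMeagre_of_countable (countable_image_setOf_deriv_eq_zero hφ)).union hregular).mono ?_
  rw [← image_union]
  refine image_mono fun z hz => ?_
  by_cases hderiv : deriv φ z = 0
  exacts [Or.inl ⟨hAV hz, hderiv⟩, Or.inr ⟨hz, hderiv⟩]

theorem nonempty_interior_inter_of_subset_image (hφ : AnalyticOnNhd ℂ φ V) (hVo : IsOpen V)
    {C W : Set ℂ} (hC : IsClosed C) (hWo : IsOpen W) (hW : W.Nonempty) (hWC : W ⊆ φ '' (V ∩ C)) :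
    (interior (V ∩ C ∩ φ ⁻¹' W)).Nonempty := by
  by_contra! hempty
  have hO : IsOpen (V ∩ φ ⁻¹' W) := hφ.continuousOn.isOpen_inter_preimage hVo hWo
  have hfrontier : V ∩ C ∩ φ ⁻¹' W ⊆ frontier C := fun z hz => by
    refine ⟨subset_closure hz.1.2, fun hzC => eq_empty_iff_forall_notMem.1 hempty z ?_⟩
    rw [inter_right_comm, interior_inter, hO.interior_eq]
    exact ⟨⟨hz.1.1, hz.2⟩, hzC⟩
  have hmeagre : IsMeagre (V ∩ C ∩ φ ⁻¹' W) :=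
    (isClosed_frontier.isNowhereDense_iff.2 (interior_frontier hC)).isMeagre.mono hfrontier
  have himage : W ⊆ φ '' (V ∩ C ∩ φ ⁻¹' W) := fun a ha => by
    obtain ⟨z, hz, rfl⟩ := hWC ha
    exact ⟨z, ⟨hz, ha⟩, rfl⟩
  exact not_isMeagre_of_isOpen hWo hW
    ((isMeagre_image_of_analyticOnNhd hφ hmeagre fun z hz => hz.1.1).mono himage)

end Meagre

namespace Weight

variable {U V : Set ℂ} {v : Weight U} {w : Weight V} {T : v.H₀ →ₗᵢ[ℂ] w.H₀}

theorem norm_smul_eval_comp_subtypeL_le (E : Submodule ℂ w.H) (z : V) :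
    ‖(w z : ℂ) • (w.eval z).comp E.subtypeL‖ ≤ 1 := by
  refine ContinuousLinearMap.opNorm_le_bound _ zero_le_one fun f => ?_
  change ‖(w z : ℂ) * (f : w.H) z‖ ≤ 1 * ‖(f : w.H)‖
  rw [norm_mul, Complex.norm_of_nonneg (w.pos z z.2).le, one_mul]
  exact w.le_norm f z

theorem mem_isometryBoundary_of_apply_eq {a z κ : ℂ} (ha : a ∈ v.boundary) (hz : z ∈ V)
    (hκ : v a ≤ w z * ‖κ‖) (h : ∀ g : v.H₀, (T g : w.H) z = κ * (g : v.H) a) :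
    z ∈ isometryBoundary T := by
  obtain ⟨haU, hext⟩ := ha
  have hva : 0 < v a := v.pos a haU
  have hμ : 0 < ‖(w z : ℂ) * κ‖ := by
    rw [norm_mul, Complex.norm_of_nonneg (w.pos z hz).le]
    exact hva.trans_le hκ
  set c : ℂ := v a / (w z * κ)
  have hc : ‖c‖ ≤ 1 := by
    rw [norm_div, div_le_one hμ, norm_mul, Complex.norm_of_nonneg hva.le,
      Complex.norm_of_nonneg (w.pos z hz).le]
    exact hκ
  have hc0 : c ≠ 0 := div_ne_zero (Complex.ofReal_ne_zero.2 hva.ne') (norm_pos_iff.1 hμ)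
  set F := (LinearMap.range T.toLinearMap).map w.H₀.subtype
  let S : v.H₀ →L[ℂ] F := (w.H₀.subtypeL.comp T.toContinuousLinearMap).codRestrict F
    fun g => ⟨T g, ⟨g, rfl⟩, rfl⟩
  have hS (g : v.H₀) : ‖S g‖ = ‖g‖ := T.norm_map g
  have hSsurj : Function.Surjective S := by
    rintro ⟨_, _, ⟨g, rfl⟩, rfl⟩
    exact ⟨g, rfl⟩
  refine ⟨hz, mem_extremePoints_of_injective_of_mapsTo (t := {e : StrongDual ℂ v.H₀ | ‖e‖ ≤ 1})
    (f := ((c • ContinuousLinearMap.precomp ℂ S).restrictScalars ℝ).toLinearMap)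
    (fun x y hxy => ?_) (fun x hx => ?_) (norm_smul_eval_comp_subtypeL_le F ⟨z, hz⟩) ?_⟩
  · refine ContinuousLinearMap.ext fun k => ?_
    obtain ⟨g, rfl⟩ := hSsurj k
    exact mul_left_cancel₀ hc0 (DFunLike.congr_fun hxy g)
  · refine ContinuousLinearMap.opNorm_le_bound _ zero_le_one fun g => ?_
    calc ‖c * x (S g)‖ = ‖c‖ * ‖x (S g)‖ := norm_mul _ _
      _ ≤ 1 * ‖g‖ := mul_le_mul hc ((x.le_of_opNorm_le hx _).trans_eq
          (by rw [one_mul, hS])) (norm_nonneg _) zero_le_one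
  · convert hext
    ext g
    change c * (w z * (T g : w.H) z) = v a * (g : v.H) a
    rw [h, ← mul_assoc (w z : ℂ), ← mul_assoc, div_mul_cancel₀ _ (norm_pos_iff.1 hμ)]

theorem Induces.subset_image [Nontrivial v.H₀] {φ h : ℂ → ℂ} (hT : Induces T φ h)
    (hU : Bornology.IsBounded U) (hv : v.IsComplete) :
    U ⊆ φ '' {z ∈ V | v (φ z) ≤ w z * ‖h z‖} := by
  intro a haU
  have ha : a ∈ v.boundary := hv.symm ▸ haU
  obtain ⟨z, hz, κ, hκ, hTz⟩ := exists_mem_forall_apply_eq_mul T ha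
  have hκ0 : κ ≠ 0 := by
    rintro rfl
    exact (v.pos a haU).ne (by rw [← hκ, norm_zero, mul_zero])
  have hκh (g : v.H₀) : κ * (g : v.H) a = h z * (g : v.H) (φ z) :=
    (hTz g).symm.trans (hT.apply_eq g z hz)
  obtain ⟨g, hg⟩ := exists_apply_ne_zero ha
  obtain rfl : a = φ z := eq_of_forall_mul_apply_eq hU ⟨g, mul_ne_zero hκ0 hg⟩ hκh
  obtain rfl : κ = h z := mul_right_cancel₀ hg (hκh g)
  exact ⟨z, ⟨hz, hκ.ge⟩, rfl⟩

theorem Induces.subset_isometryBoundary_of_subsingleton [Subsingleton v.H₀] {φ h : ℂ → ℂ}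
    (hT : Induces T φ h) (hv : v.IsComplete) : V ⊆ isometryBoundary T := by
  intro z hz
  have hφz : φ z ∈ v.boundary := hv.symm ▸ hT.image_eq ▸ mem_image_of_mem φ hz
  refine mem_isometryBoundary_of_apply_eq (κ := v (φ z) / w z) hφz hz ?_ fun g => ?_
  · rw [norm_div, Complex.norm_of_nonneg (w.pos z hz).le, mul_div_cancel₀ _ (w.pos z hz).ne',
      Complex.norm_real]
    exact le_abs_self _
  · rw [Subsingleton.elim g 0, map_zero]
    exact (mul_zero _).symm

theorem Induces.nonempty_interior_isometryBoundary_inter {φ h : ℂ → ℂ} (hT : Induces T φ h)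
    (hU : Bornology.IsBounded U) (hVo : IsOpen V) (hv : v.IsComplete) {W : Set ℂ} (hWo : IsOpen W)
    (hW : W.Nonempty) (hWU : W ⊆ U) : (interior (isometryBoundary T ∩ φ ⁻¹' W)).Nonempty := by
  have hφ : ContinuousOn φ V := hT.differentiableOn_map.continuousOn
  have hφU : MapsTo φ V U := mapsTo_iff_image_subset.2 hT.image_eq.subset
  rcases subsingleton_or_nontrivial v.H₀ with _ | _
  · obtain ⟨_, ha⟩ := hW
    obtain ⟨z, hz, rfl⟩ := hT.image_eq.superset (hWU ha)
    exact ⟨z, mem_interior.2 ⟨V ∩ φ ⁻¹' W,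
      inter_subset_inter_left _ (hT.subset_isometryBoundary_of_subsingleton hv),
      hφ.isOpen_inter_preimage hVo hWo, hz, ha⟩⟩
  · have hcont : ContinuousOn (fun z => v (φ z) - w z * ‖h z‖) V :=
      (v.continuousOn.comp hφ hφU).sub
        (w.continuousOn.mul hT.differentiableOn_factor.continuousOn.norm)
    obtain ⟨C, hC, hVC⟩ := continuousOn_iff_isClosed.1 hcont (Iic 0) isClosed_Iic
    have hmem {z : ℂ} (hz : z ∈ V) : z ∈ C ↔ v (φ z) ≤ w z * ‖h z‖ := by
      simpa [hz] using (Set.ext_iff.1 hVC z).symm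
    refine (nonempty_interior_inter_of_subset_image (hT.differentiableOn_map.analyticOnNhd hVo) hVo
      hC hWo hW (hWU.trans ((hT.subset_image hU hv).trans ?_))).mono ?_
    · exact image_mono fun z hz => ⟨hz.1, (hmem hz.1).2 hz.2⟩
    · exact interior_mono (inter_subset_inter_left _ fun z hz =>
        mem_isometryBoundary_of_apply_eq (hv.symm ▸ hφU hz.1) hz.1 ((hmem hz.1).1 hz.2)
          fun g => hT.apply_eq g z hz.1)

end Weight

theorem corollary4p2_general {U V : Set ℂ} (hUb : Bornology.IsBounded U)
    (hU : interior (closure U) = U) (hVo : IsOpen V) (v : Weight U) (w : Weight V)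
    (hv : v.IsComplete) (T : v.H₀ →ₗᵢ[ℂ] w.H₀) :
    (IsPreconnected V → Nontrivial v.H₀ → ∃ φ h : ℂ → ℂ, Weight.Induces T φ h) ∧
    ∀ φ h : ℂ → ℂ, Weight.Induces T φ h → ∀ a ∈ U, ∀ r : ℝ, 0 < r →
      (interior (Weight.isometryBoundary T ∩ φ ⁻¹' ball a r)).Nonempty := by
  refine ⟨fun hV _ => Weight.exists_induces hUb hU hVo hV hv T, fun φ h hT a ha r hr => ?_⟩
  refine (hT.nonempty_interior_isometryBoundary_inter hUb hVo hv (W := ball a r ∩ U)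
    (isOpen_ball.inter (hU ▸ isOpen_interior)) ⟨a, mem_ball_self hr, ha⟩ inter_subset_right).mono ?_
  exact interior_mono (inter_subset_inter_right _ (preimage_mono inter_subset_left))

theorem corollary4p2 {V : Set ℂ} (hVo : IsOpen V) (hVb : Bornology.IsBounded V)
    (v : Weight (Metric.ball (0 : ℂ) 1)) (w : Weight V) (hv : v.IsComplete)
    (T : v.H₀ →ₗᵢ[ℂ] w.H₀) :
    (IsConnected V → Nontrivial v.H₀ → ∃ φ h : ℂ → ℂ, Weight.Induces T φ h) ∧
    ∀ φ h : ℂ → ℂ, Weight.Induces T φ h →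
      ∀ a ∈ Metric.ball (0 : ℂ) 1, ∀ r : ℝ, 0 < r →
        (interior (closure (Weight.isometryBoundary T ∩ φ ⁻¹' Metric.ball a r))).Nonempty := by
  obtain ⟨hinduces, hboundary⟩ := corollary4p2_general Metric.isBounded_ball
    (by rw [closure_ball _ one_ne_zero, interior_closedBall _ one_ne_zero]) hVo v w hv T
  exact ⟨fun hV => hinduces hV.isPreconnected, fun φ h hT a ha r hr =>
    (hboundary φ h hT a ha r hr).mono (interior_mono subset_closure)⟩
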